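/- Let $X$ be a separable metrizable space that is almost zero-dimensional, meaning that every point of $X$ has a base of (not necessarily open) neighborhoods each of which is an intersection of clopen subsets of $X$. Let $\mathcal{K}(X)$ denote the hyperspace of non-empty compact subsets of $X$ with the Vietoris topology. Then $\dim \mathcal{K}(X)\leq 1$, and $\dim \mathcal{K}(X)=1$ if and only if $\dim X=1$. Here $\dim$ is the topological dimension of separable metrizable spaces, taken as the small inductive dimension (for such spaces it coincides with the large inductive dimension and the covering dimension). -/

import Mathlib

/-- A topological space is almost zero-dimensional if every point has a neighbourhood base
(of not necessarily open neighbourhoods) each of whose members is an intersection of clopen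
subsets of the space. -/
def IsAlmostZeroDimensional (X : Type*) [TopologicalSpace X] : Prop :=
  ∀ x : X, ∀ U ∈ nhds x, ∃ V ∈ nhds x, V ⊆ U ∧
    ∃ S : Set (Set X), (∀ C ∈ S, IsClopen C) ∧ V = ⋂₀ S

open Set Topology TopologicalSpace

/-! Clopen-closed sets can be interpolated (`IsAlmostZeroDimensional.exists_between`), so a Urysohn
construction gives continuous functions that are also lower semicontinuous for the clopen topology.
A weighted sum `φ` of countably many of them, together with the clopen sets, generates the topology.
A basic set `C ∩ φ ⁻¹' Ioo a b` has its frontier in `φ ⁻¹' {a, b}`, where `φ` has clopen fibres, so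
the frontier is zero-dimensional and the space has dimension at most 1.

The hyperspace inherits almost zero-dimensionality, hence the bound. Since having a clopen basis
passes between `X` and its hyperspace in both directions, dimension 1 does too. -/

/-- A set is clopen-closed if it is an intersection of clopen sets, i.e. if each point of its
complement has a clopen neighbourhood that misses it. -/
def IsClopenClosed {X : Type*} [TopologicalSpace X] (V : Set X) : Prop :=
  ∀ y ∉ V, ∃ C, IsClopen C ∧ y ∈ C ∧ Disjoint C V

/-- A real function is clopen-lower semicontinuous if it is lower semicontinuous for the topology
generated by the clopen sets. -/
def ClopenLSC {X : Type*} [TopologicalSpace X] (f : X → ℝ) : Prop :=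
  ∀ x, ∀ t < f x, ∃ C, IsClopen C ∧ x ∈ C ∧ ∀ y ∈ C, t < f y

/-! ### Clopen-closed sets and their interpolation -/

section ClopenClosed

variable {X : Type*} [TopologicalSpace X]

theorem isClopenClosed_sInter {S : Set (Set X)} (hS : ∀ C ∈ S, IsClopen C) :
    IsClopenClosed (⋂₀ S) := by
  intro y hy
  simp only [mem_sInter, not_forall] at hy
  obtain ⟨C, hC, hyC⟩ := hy
  exact ⟨Cᶜ, (hS C hC).compl, hyC,
    disjoint_compl_left.mono_right (sInter_subset_of_mem hC)⟩

theorem IsClopen.isClopenClosed {C : Set X} (hC : IsClopen C) : IsClopenClosed C :=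
  fun _ hy ↦ ⟨Cᶜ, hC.compl, hy, disjoint_compl_left⟩

theorem IsClopenClosed.eq_sInter {V : Set X} (hV : IsClopenClosed V) :
    V = ⋂₀ {C | IsClopen C ∧ V ⊆ C} := by
  refine subset_antisymm (fun x hx C hC ↦ hC.2 hx) fun x hx ↦ ?_
  by_contra hxV
  obtain ⟨C, hC, hxC, hd⟩ := hV x hxV
  exact hx Cᶜ ⟨hC.compl, hd.symm.subset_compl_right⟩ hxC

theorem IsClopenClosed.isClosed {V : Set X} (hV : IsClopenClosed V) : IsClosed V := by
  rw [hV.eq_sInter]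
  exact isClosed_sInter fun C hC ↦ hC.1.isClosed

theorem IsClopenClosed.union {V W : Set X} (hV : IsClopenClosed V) (hW : IsClopenClosed W) :
    IsClopenClosed (V ∪ W) := by
  intro y hy
  rw [mem_union, not_or] at hy
  obtain ⟨C, hC, hyC, hCV⟩ := hV y hy.1
  obtain ⟨D, hD, hyD, hDW⟩ := hW y hy.2
  exact ⟨C ∩ D, hC.inter hD, ⟨hyC, hyD⟩, disjoint_union_right.2
    ⟨hCV.mono_left inter_subset_left, hDW.mono_left inter_subset_right⟩⟩

theorem IsClopenClosed.inter {V W : Set X} (hV : IsClopenClosed V) (hW : IsClopenClosed W) :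
    IsClopenClosed (V ∩ W) := by
  intro y hy
  by_cases hyV : y ∈ V
  · obtain ⟨C, hC, hyC, hd⟩ := hW y fun h ↦ hy ⟨hyV, h⟩
    exact ⟨C, hC, hyC, hd.mono_right inter_subset_right⟩
  · obtain ⟨C, hC, hyC, hd⟩ := hV y hyV
    exact ⟨C, hC, hyC, hd.mono_right inter_subset_left⟩

theorem IsClopenClosed.biUnion_lt {V : ℕ → Set X} (hV : ∀ n, IsClopenClosed (V n)) (k : ℕ) :
    IsClopenClosed (⋃ n < k, V n) := by
  induction k with
  | zero => simpa using isClopen_empty.isClopenClosed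
  | succ k ih =>
    rw [biUnion_lt_succ]
    exact ih.union (hV k)

theorem isAlmostZeroDimensional_iff : IsAlmostZeroDimensional X ↔
    ∀ x : X, ∀ U ∈ 𝓝 x, ∃ V ∈ 𝓝 x, V ⊆ U ∧ IsClopenClosed V := by
  refine forall_congr' fun x ↦ forall₂_congr fun U _ ↦ exists_congr fun V ↦
    and_congr_right fun _ ↦ and_congr_right fun _ ↦ ⟨?_, fun h ↦ ⟨_, fun C hC ↦ hC.1, h.eq_sInter⟩⟩
  rintro ⟨S, hS, rfl⟩
  exact isClopenClosed_sInter hS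

theorem IsClopenClosed.exists_seq [SecondCountableTopology X] {A : Set X}
    (hA : IsClopenClosed A) : ∃ C : ℕ → Set X, (∀ n, IsClopen (C n)) ∧ A = ⋂ n, C n := by
  obtain ⟨T, hT, hTS, hTU⟩ := isOpen_sUnion_countable (compl '' {C | IsClopen C ∧ A ⊆ C}) <| by
    rintro _ ⟨C, hC, rfl⟩
    exact hC.1.compl.isOpen
  have hA' : Aᶜ = ⋃₀ T := by rw [hTU, ← compl_sInter, ← hA.eq_sInter]
  obtain ⟨D, hD⟩ := (hT.insert ∅).exists_eq_range (insert_nonempty _ _)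
  refine ⟨fun n ↦ (D n)ᶜ, fun n ↦ ?_, ?_⟩
  · have : D n ∈ insert ∅ T := hD ▸ mem_range_self n
    rcases this with h | h
    · simp [h, isClopen_univ]
    · obtain ⟨C, hC, hCD⟩ := hTS h
      simpa [← hCD] using hC.1
  · rw [← compl_iUnion, ← sUnion_range, ← hD, sUnion_insert, empty_union, ← hA', compl_compl]

/-- In an almost zero-dimensional space, clopen-closed sets can be interpolated. -/
theorem IsAlmostZeroDimensional.exists_between [SecondCountableTopology X]
    (hX : IsAlmostZeroDimensional X) {A U : Set X} (hA : IsClopenClosed A) (hU : IsOpen U)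
    (hAU : A ⊆ U) : ∃ D, IsClopenClosed D ∧ A ⊆ interior D ∧ D ⊆ U := by
  rw [isAlmostZeroDimensional_iff] at hX
  obtain ⟨C, hC, rfl⟩ := hA.exists_seq
  have : Nonempty {V : Set X // IsClopenClosed V ∧ V ⊆ U} :=
    ⟨∅, isClopen_empty.isClopenClosed, empty_subset U⟩
  obtain ⟨V, hV⟩ := (HereditarilyLindelofSpace.isLindelof (⋂ n, C n)).indexed_countable_subcover
    (fun V : {V : Set X // IsClopenClosed V ∧ V ⊆ U} ↦ interior V.1) (fun _ ↦ isOpen_interior)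
    fun x hx ↦ by
      obtain ⟨V, hVx, hVU, hV⟩ := hX x U (hU.mem_nhds (hAU hx))
      exact mem_iUnion.2 ⟨⟨V, hV, hVU⟩, mem_interior_iff_mem_nhds.2 hVx⟩
  -- Since `E n ⊆ C k` for `n ≥ k`, a point outside `C k` has to be separated from only finitely
  -- many `E n`; this keeps the infinite union clopen-closed.
  let E (n : ℕ) : Set X := (V n).1 ∩ ⋂ i ≤ n, C i
  have hfin (n : ℕ) : IsClopen (⋂ i ≤ n, C i) := (finite_le_nat n).isClopen_biInter fun i _ ↦ hC i
  have hE (n : ℕ) : IsClopenClosed (E n) := (V n).2.1.inter (hfin n).isClopenClosed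
  refine ⟨(⋂ n, C n) ∪ ⋃ n, E n, fun y hy ↦ ?_, fun x hx ↦ ?_,
    union_subset hAU <| iUnion_subset fun n ↦ inter_subset_left.trans (V n).2.2⟩
  · rw [mem_union, not_or, mem_iInter, not_forall] at hy
    obtain ⟨⟨k, hk⟩, hy⟩ := hy
    obtain ⟨D, hD, hyD, hd⟩ := IsClopenClosed.biUnion_lt hE k y fun h ↦
      hy (iUnion₂_subset (fun n _ ↦ subset_iUnion E n) h)
    refine ⟨D ∩ (C k)ᶜ, hD.inter (hC k).compl, ⟨hyD, hk⟩, disjoint_left.2 ?_⟩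
    rintro z ⟨hzD, hzk⟩ (hz | hz)
    · exact hzk (mem_iInter.1 hz k)
    · obtain ⟨n, hn⟩ := mem_iUnion.1 hz
      rcases lt_or_ge n k with h | h
      · exact disjoint_left.1 hd hzD (mem_biUnion (show n ∈ {n | n < k} from h) hn)
      · exact hzk (mem_iInter₂.1 hn.2 k h)
  · obtain ⟨n, hn⟩ := mem_iUnion.1 (hV hx)
    have hsub : interior (V n).1 ∩ ⋂ i ≤ n, C i ⊆ (⋂ n, C n) ∪ ⋃ n, E n :=
      (inter_subset_inter_left _ interior_subset).trans <|
        (subset_iUnion E n).trans subset_union_right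
    exact interior_maximal hsub (isOpen_interior.inter (hfin n).isOpen)
      ⟨hn, mem_iInter₂.2 fun i _ ↦ mem_iInter.1 hx i⟩

end ClopenClosed

/-! ### Urysohn functions from dyadic chains -/

section Urysohn

variable {X : Type*}

/-- Successive dyadic refinements of a chain of sets by means of an interpolation operator `m`. -/
def dyadicChain (m : Set X → Set X → Set X) (A B : Set X) : ℕ → ℕ → Set X
  | 0, 0 => A
  | 0, 1 => B
  | 0, _ => univ
  | n + 1, k =>
    if Even k then dyadicChain m A B n (k / 2)
    else m (dyadicChain m A B n (k / 2)) (dyadicChain m A B n (k / 2 + 1))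

theorem dyadicChain_two_mul (m : Set X → Set X → Set X) (A B : Set X) (n k : ℕ) :
    dyadicChain m A B (n + 1) (2 * k) = dyadicChain m A B n k := by
  simp [dyadicChain]

theorem dyadicChain_mul_pow (m : Set X → Set X → Set X) (A B : Set X) (n k i : ℕ) :
    dyadicChain m A B (n + i) (k * 2 ^ i) = dyadicChain m A B n k := by
  induction i with
  | zero => simp
  | succ i ih => rw [← add_assoc, pow_succ', mul_left_comm, dyadicChain_two_mul, ih]

variable [TopologicalSpace X]

/-- A chain of clopen-closed sets indexed by dyadic rationals gives rise to a continuous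
clopen-lower semicontinuous function. -/
theorem exists_continuous_clopenLSC_of_chain {D : ℕ → ℕ → Set X}
    (hDc : ∀ n k, IsClopenClosed (D n k)) (hD : ∀ n k, D n k ⊆ interior (D n (k + 1)))
    (hpow : ∀ n k i, D (n + i) (k * 2 ^ i) = D n k) (h2 : D 0 2 = univ) :
    ∃ f : X → ℝ, Continuous f ∧ ClopenLSC f ∧ (∀ x, 0 ≤ f x) ∧ (∀ x, f x ≤ 2) ∧
      (∀ x ∈ D 0 0, f x = 0) ∧ ∀ x ∉ D 0 1, 1 ≤ f x := by
  have hmono (n : ℕ) : Monotone (D n) :=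
    monotone_nat_of_le_succ fun k ↦ (hD n k).trans interior_subset
  have hle {n k m j : ℕ} (h : (k : ℝ) / 2 ^ n ≤ j / 2 ^ m) : D n k ⊆ D m j := by
    rw [← hpow n k m, ← hpow m j n, add_comm m n]
    refine hmono _ ?_
    rw [div_le_div_iff₀ (by positivity) (by positivity)] at h
    exact_mod_cast h
  let S (x : X) : Set ℝ := {t | ∃ n k : ℕ, x ∈ D n k ∧ t = k / 2 ^ n}
  have hS2 (x : X) : 2 ∈ S x := ⟨0, 2, h2 ▸ mem_univ x, by norm_num⟩
  have hS0 (x : X) : 0 ∈ lowerBounds (S x) := by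
    rintro _ ⟨n, k, -, rfl⟩
    positivity
  have hbdd (x : X) : BddBelow (S x) := ⟨0, hS0 x⟩
  let f (x : X) : ℝ := sInf (S x)
  have hf_le {x : X} {n k : ℕ} (h : x ∈ D n k) : f x ≤ k / 2 ^ n :=
    csInf_le (hbdd x) ⟨n, k, h, rfl⟩
  have hle_f {x : X} {n k : ℕ} (h : x ∉ D n k) : (k : ℝ) / 2 ^ n ≤ f x := by
    refine le_csInf ⟨_, hS2 x⟩ ?_
    rintro _ ⟨m, j, hx, rfl⟩
    by_contra! hlt
    exact h (hle hlt.le hx)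
  have hf0 (x : X) : 0 ≤ f x := le_csInf ⟨_, hS2 x⟩ (hS0 x)
  have hdyadic {s t : ℝ} (hs : 0 ≤ s) (hst : s < t) :
      ∃ n k : ℕ, s < (k : ℝ) / 2 ^ n ∧ (k : ℝ) / 2 ^ n < t := by
    obtain ⟨n, hn⟩ := exists_pow_lt_of_lt_one (sub_pos.2 hst) (show (1 / 2 : ℝ) < 1 by norm_num)
    have hp : (0 : ℝ) < 2 ^ n := by positivity
    refine ⟨n, ⌊s * 2 ^ n⌋₊ + 1, ?_, ?_⟩
    · rw [lt_div_iff₀ hp]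
      exact_mod_cast Nat.lt_floor_add_one _
    · have := Nat.floor_le (show 0 ≤ s * 2 ^ n by positivity)
      rw [div_lt_iff₀ hp]
      rw [one_div, inv_pow, inv_lt_iff_one_lt_mul₀ hp] at hn
      push_cast
      linarith
  have hlsc : ClopenLSC f := by
    intro x t ht
    -- `hdyadic` needs a nonnegative lower bound, hence `max t 0`; if `f x ≤ 0`, then `t < 0` and
    -- the whole space serves.
    obtain ⟨s, hs, hsx⟩ : ∃ s, max t 0 < s ∧ (s < f x ∨ f x ≤ 0) := by
      rcases lt_or_ge 0 (f x) with h | h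
      · obtain ⟨s, hs, hs'⟩ := exists_between (max_lt ht h)
        exact ⟨s, hs, .inl hs'⟩
      · exact ⟨_, lt_add_one _, .inr h⟩
    rcases hsx with hsx | hx0
    · obtain ⟨n, k, h1, h2⟩ := hdyadic ((le_max_right t 0).trans hs.le) hsx
      obtain ⟨C, hC, hxC, hd⟩ := hDc n k x fun h ↦ (hf_le h).not_gt h2
      exact ⟨C, hC, hxC, fun y hy ↦ ((le_max_left t 0).trans_lt hs).trans <|
        h1.trans_le (hle_f (disjoint_left.1 hd hy))⟩
    · exact ⟨univ, isClopen_univ, mem_univ x, fun y _ ↦ (ht.trans_le hx0).trans_le (hf0 y)⟩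
  refine ⟨f, ?_, hlsc, hf0, fun x ↦ csInf_le (hbdd x) (hS2 x), fun x hx ↦ ?_, fun x hx ↦ ?_⟩
  · refine continuous_iff_continuousAt.2 fun x ↦ tendsto_order.2 ⟨fun t ht ↦ ?_, fun t ht ↦ ?_⟩
    · obtain ⟨C, hC, hxC, h⟩ := hlsc x t ht
      exact Filter.mem_of_superset (hC.isOpen.mem_nhds hxC) h
    · obtain ⟨_, ⟨n, k, hx, rfl⟩, hlt⟩ := exists_lt_of_csInf_lt ⟨_, hS2 x⟩ ht
      obtain ⟨m, j, h1, h2⟩ := hdyadic (show 0 ≤ (k : ℝ) / 2 ^ n by positivity) hlt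
      have hsub : D n k ⊆ interior (D (m + n) (j * 2 ^ n)) := by
        rw [← hpow n k m, add_comm m n]
        refine (hD _ _).trans (interior_mono (hmono _ ?_))
        rw [div_lt_div_iff₀ (by positivity) (by positivity)] at h1
        exact_mod_cast h1
      rw [hpow] at hsub
      filter_upwards [isOpen_interior.mem_nhds (hsub hx)] with y hy
      exact (hf_le (interior_subset hy)).trans_lt h2
  · exact le_antisymm (by simpa using hf_le hx) (hf0 x)
  · simpa using hle_f hx

/-- A Urysohn lemma for almost zero-dimensional spaces. -/
theorem IsAlmostZeroDimensional.exists_continuous_clopenLSC [SecondCountableTopology X]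
    (hX : IsAlmostZeroDimensional X) {A U : Set X} (hA : IsClopenClosed A) (hU : IsOpen U)
    (hAU : A ⊆ U) : ∃ f : X → ℝ, Continuous f ∧ ClopenLSC f ∧ (∀ x, 0 ≤ f x) ∧ (∀ x, f x ≤ 2) ∧
      (∀ x ∈ A, f x = 0) ∧ ∀ x ∉ U, 1 ≤ f x := by
  obtain ⟨B, hB, hAB, hBU⟩ := hX.exists_between hA hU hAU
  choose! m hm hAm hmB using fun (S T : Set X) (h : IsClopenClosed S ∧ S ⊆ interior T) ↦
    hX.exists_between h.1 isOpen_interior h.2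
  have key (n : ℕ) : ∀ k, IsClopenClosed (dyadicChain m A B n k) ∧
      dyadicChain m A B n k ⊆ interior (dyadicChain m A B n (k + 1)) := by
    induction n with
    | zero =>
      rintro (_ | _ | k)
      · exact ⟨hA, hAB⟩
      · simpa [dyadicChain] using hB
      · simpa [dyadicChain] using isClopen_univ.isClopenClosed
    | succ n ih =>
      intro k
      obtain ⟨j, rfl | rfl⟩ := k.even_or_odd'
      · have h : (2 * j + 1) / 2 = j := by omega
        simpa [dyadicChain, h] using ⟨(ih j).1, hAm _ _ (ih j)⟩
      · have h : (2 * j + 1) / 2 = j := by omega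
        have h' : (2 * j + 1 + 1) / 2 = j + 1 := by omega
        have h'' : Even (2 * j + 1 + 1) := ⟨j + 1, by omega⟩
        simpa [dyadicChain, h, h', h''] using ⟨hm _ _ (ih j), hmB _ _ (ih j)⟩
  obtain ⟨f, hf, hfc, hf0, hf2, hfA, hfB⟩ := exists_continuous_clopenLSC_of_chain
    (fun n k ↦ (key n k).1) (fun n k ↦ (key n k).2) (dyadicChain_mul_pow m A B) rfl
  exact ⟨f, hf, hfc, hf0, hf2, hfA, fun x hx ↦ hfB x fun h ↦ hx (hBU h)⟩

end Urysohn

/-! ### The generating function and the dimension bound -/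

section Dimension

variable {X : Type*} [TopologicalSpace X]

theorem ClopenLSC.const_mul {f : X → ℝ} (hf : ClopenLSC f) {c : ℝ} (hc : 0 < c) :
    ClopenLSC fun x ↦ c * f x := by
  intro x t ht
  obtain ⟨C, hC, hx, h⟩ := hf x (t / c) ((div_lt_iff₀' hc).2 ht)
  exact ⟨C, hC, hx, fun y hy ↦ (div_lt_iff₀' hc).1 (h y hy)⟩

theorem ClopenLSC.add {f g : X → ℝ} (hf : ClopenLSC f) (hg : ClopenLSC g) :
    ClopenLSC fun x ↦ f x + g x := by
  intro x t ht
  obtain ⟨C, hC, hx, h⟩ := hf x (f x - (f x + g x - t) / 2) (by linarith)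
  obtain ⟨D, hD, hx', h'⟩ := hg x (g x - (f x + g x - t) / 2) (by linarith)
  exact ⟨C ∩ D, hC.inter hD, ⟨hx, hx'⟩, fun y hy ↦ by linarith [h y hy.1, h' y hy.2]⟩

theorem clopenLSC_const (c : ℝ) : ClopenLSC fun _ : X ↦ c :=
  fun x _ ht ↦ ⟨univ, isClopen_univ, mem_univ x, fun _ _ ↦ ht⟩

theorem ClopenLSC.sum {ι : Type*} {f : ι → X → ℝ} (hf : ∀ i, ClopenLSC (f i)) (s : Finset ι) :
    ClopenLSC fun x ↦ ∑ i ∈ s, f i x := by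
  classical
  induction s using Finset.induction_on with
  | empty => simpa using clopenLSC_const 0
  | insert i s hi ih => simpa [Finset.sum_insert hi] using (hf i).add ih

/-- The terms are nonnegative, so the sum dominates each of its finite partial sums, one of which
already exceeds `t` at `x`. -/
theorem ClopenLSC.tsum {ι : Type*} {f : ι → X → ℝ} (hf : ∀ i, ClopenLSC (f i))
    (h0 : ∀ i x, 0 ≤ f i x) (hs : ∀ x, Summable fun i ↦ f i x) :
    ClopenLSC fun x ↦ ∑' i, f i x := by
  intro x t ht
  obtain ⟨s, hs'⟩ := ((hs x).hasSum.eventually_const_lt ht).exists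
  obtain ⟨C, hC, hx, h⟩ := ClopenLSC.sum hf s x t hs'
  exact ⟨C, hC, hx, fun y hy ↦ (h y hy).trans_le ((hs y).sum_le_tsum s fun i _ ↦ h0 i y)⟩

/-- In an almost zero-dimensional space there is a continuous real function that together with the
clopen sets generates the topology. -/
theorem IsAlmostZeroDimensional.exists_isTopologicalBasis [SecondCountableTopology X]
    (hX : IsAlmostZeroDimensional X) : ∃ φ : X → ℝ, Continuous φ ∧
      IsTopologicalBasis {V | ∃ C a b, IsClopen C ∧ V = C ∩ φ ⁻¹' Ioo a b} := by
  classical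
  let G : Set (X → ℝ) := {f | Continuous f ∧ ClopenLSC f ∧ (∀ x, 0 ≤ f x) ∧ ∀ x, f x ≤ 2}
  obtain ⟨F, hFG, hF⟩ : ∃ F : ℕ → X → ℝ, (∀ n, F n ∈ G) ∧
      ∀ x U, x ∈ U → IsOpen U → ∃ n, F n x = 0 ∧ ∀ y ∉ U, 1 ≤ F n y := by
    let Q (p : Set X × Set X) : Prop := ∃ f ∈ G, (∀ x ∈ p.1, f x = 0) ∧ ∀ x ∉ p.2, 1 ≤ f x
    let P : Set (Set X × Set X) := {p ∈ countableBasis X ×ˢ countableBasis X | Q p}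
    have hP : P.Countable :=
      ((countable_countableBasis X).prod (countable_countableBasis X)).mono inter_subset_left
    choose! g hg hg0 hg1 using fun (p : Set X × Set X) (h : Q p) ↦ h
    obtain ⟨F, hF⟩ := ((hP.image g).insert 0).exists_eq_range (insert_nonempty _ _)
    refine ⟨F, fun n ↦ ?_, fun x U hx hU ↦ ?_⟩
    · have : F n ∈ insert 0 (g '' P) := hF ▸ mem_range_self n
      rcases this with h | ⟨p, hp, h⟩
      · rw [h]
        exact ⟨continuous_const, clopenLSC_const 0, fun _ ↦ le_rfl, fun _ ↦ zero_le_two⟩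
      · exact h ▸ hg p hp.2
    · have hb := isBasis_countableBasis X
      obtain ⟨V, hV, hxV, hVU⟩ := hb.exists_subset_of_mem_open hx hU
      obtain ⟨A, hAx, hAV, hA⟩ :=
        isAlmostZeroDimensional_iff.1 hX x V ((hb.isOpen hV).mem_nhds hxV)
      obtain ⟨W, hW, hxW, hWA⟩ := hb.mem_nhds_iff.1 hAx
      obtain ⟨f, hf, hfc, hf0, hf2, hfA, hfV⟩ :=
        hX.exists_continuous_clopenLSC hA (hb.isOpen hV) hAV
      have hQ : Q (W, V) := ⟨f, ⟨hf, hfc, hf0, hf2⟩, fun y hy ↦ hfA y (hWA hy), hfV⟩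
      have : g (W, V) ∈ range F := hF ▸ mem_insert_of_mem _ ⟨_, ⟨⟨hW, hV⟩, hQ⟩, rfl⟩
      obtain ⟨n, hn⟩ := this
      exact ⟨n, hn ▸ hg0 _ hQ x hxW, fun y hy ↦ hn ▸ hg1 _ hQ y fun h ↦ hy (hVU h)⟩
  let h (n : ℕ) (x : X) : ℝ := (1 / 2) ^ n * F n x
  have hh0 (n : ℕ) (x : X) : 0 ≤ h n x := mul_nonneg (by positivity) ((hFG n).2.2.1 x)
  have hh2 (n : ℕ) (x : X) : h n x ≤ (1 / 2) ^ n * 2 :=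
    mul_le_mul_of_nonneg_left ((hFG n).2.2.2 x) (by positivity)
  have hsum2 : Summable fun n : ℕ ↦ (1 / 2 : ℝ) ^ n * 2 := summable_geometric_two.mul_right 2
  have hsum (x : X) : Summable fun n ↦ h n x :=
    .of_nonneg_of_le (fun n ↦ hh0 n x) (fun n ↦ hh2 n x) hsum2
  let φ (x : X) : ℝ := ∑' n, h n x
  have hφ : Continuous φ := by
    refine continuous_tsum (fun n ↦ continuous_const.mul (hFG n).1) hsum2 fun n x ↦ ?_
    rw [Real.norm_of_nonneg (hh0 n x)]
    exact hh2 n x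
  refine ⟨φ, hφ, isTopologicalBasis_of_isOpen_of_nhds ?_ fun x U hx hU ↦ ?_⟩
  · rintro _ ⟨C, a, b, hC, rfl⟩
    exact hC.isOpen.inter (isOpen_Ioo.preimage hφ)
  obtain ⟨n, hn0, hn1⟩ := hF x U hx hU
  -- On a clopen set around `x` the other terms drop by less than `ε / 2`, where `ε = (1 / 2) ^ n`.
  -- If also `φ y < φ x + ε / 2`, then `h n y < ε`, which forces `y ∈ U`.
  have hlsc : ClopenLSC fun x ↦ ∑' m, if m = n then 0 else h m x := by
    refine ClopenLSC.tsum (fun m ↦ ?_) (fun m x ↦ ?_) fun x ↦ ?_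
    · split_ifs
      · exact clopenLSC_const 0
      · exact (hFG m).2.1.const_mul (by positivity)
    · split_ifs
      exacts [le_rfl, hh0 m x]
    · refine .of_nonneg_of_le (fun m ↦ ?_) (fun m ↦ ?_) (hsum x) <;> split_ifs
      exacts [le_rfl, hh0 m x, hh0 m x, le_rfl]
  have hsplit (y : X) : φ y = h n y + ∑' m, if m = n then 0 else h m y :=
    (hsum y).tsum_eq_add_tsum_ite n
  have hε : (0 : ℝ) < (1 / 2) ^ n := by positivity
  obtain ⟨C, hC, hxC, hCy⟩ := hlsc x (_ - (1 / 2) ^ n / 2) (sub_lt_self _ (half_pos hε))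
  refine ⟨_, ⟨C, φ x - (1 / 2) ^ n / 2, φ x + (1 / 2) ^ n / 2, hC, rfl⟩,
    ⟨hxC, by constructor <;> linarith⟩, fun y hy ↦ ?_⟩
  by_contra hyU
  have h1 : (1 / 2 : ℝ) ^ n ≤ h n y := le_mul_of_one_le_right hε.le (hn1 y hyU)
  have h2 : h n x = 0 := by simp [h, hn0]
  have h3 := hCy y hy.1
  have h4 := hy.2.2
  have h5 := hsplit x
  have h6 := hsplit y
  linarith

/-- An almost zero-dimensional second countable space is at most one-dimensional. -/
theorem IsAlmostZeroDimensional.hasSmallInductiveDimensionLE_one [SecondCountableTopology X]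
    (hX : IsAlmostZeroDimensional X) : HasSmallInductiveDimensionLE X 1 := by
  obtain ⟨φ, hφ, hb⟩ := hX.exists_isTopologicalBasis
  refine .succ 1 _ hb ?_
  rintro _ ⟨C, a, b, hC, rfl⟩
  have hfr (y : X) (hy : y ∈ frontier (C ∩ φ ⁻¹' Ioo a b)) : φ y = a ∨ φ y = b := by
    have hopen : IsOpen (C ∩ φ ⁻¹' Ioo a b) := hC.isOpen.inter (isOpen_Ioo.preimage hφ)
    rw [hopen.frontier_eq] at hy
    have hcl : y ∈ C ∩ φ ⁻¹' Icc a b := closure_minimal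
      (inter_subset_inter_right C (preimage_mono Ioo_subset_Icc_self))
      (hC.isClosed.inter (isClosed_Icc.preimage hφ)) hy.1
    by_contra! hne
    exact hy.2 ⟨hcl.1, hcl.2.1.lt_of_ne' hne.1, hcl.2.2.lt_of_ne hne.2⟩
  -- From here on only the fact that `φ` takes at most two values on `Z` matters.
  generalize frontier (C ∩ φ ⁻¹' Ioo a b) = Z at hfr
  rw [hasSmallInductiveDimensionLT_one_iff]
  refine isTopologicalBasis_of_isOpen_of_nhds (fun _ h ↦ h.isOpen) fun x U hx hU ↦ ?_
  obtain ⟨O, hO, rfl⟩ := isOpen_induced_iff.1 hU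
  obtain ⟨_, ⟨D, c, d, hD, rfl⟩, hxD, hDO⟩ := hb.exists_subset_of_mem_open hx hO
  have hψ : Continuous fun y : Z ↦ φ y := hφ.comp continuous_subtype_val
  have hfib : IsClopen {y : Z | φ y = φ x} := by
    refine ⟨isClosed_eq hψ continuous_const, ?_⟩
    rw [← isClosed_compl_iff]
    have : {y : Z | φ y = φ x}ᶜ = {y : Z | φ y ∈ ({a, b} \ {φ x} : Set ℝ)} := by
      ext y
      have := hfr y y.2
      simp [this]
    rw [this]
    exact ((toFinite ({a, b} \ {φ x} : Set ℝ)).isClosed).preimage hψ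
  exact ⟨_, (hD.preimage continuous_subtype_val).inter hfib, ⟨hxD.1, rfl⟩,
    fun y hy ↦ hDO ⟨hy.1, by simpa [show φ y = φ x from hy.2] using hxD.2⟩⟩

end Dimension

/-! ### Transfer to the Vietoris hyperspace -/

section Hyperspace

variable {X : Type*} [TopologicalSpace X]

theorem IsAlmostZeroDimensional.exists_isClopenClosed_between (hX : IsAlmostZeroDimensional X)
    {K U : Set X} (hK : IsCompact K) (hU : IsOpen U) (hKU : K ⊆ U) :
    ∃ V, IsClopenClosed V ∧ K ⊆ interior V ∧ V ⊆ U := by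
  rw [isAlmostZeroDimensional_iff] at hX
  refine hK.induction_on (p := fun s ↦ ∃ V, IsClopenClosed V ∧ s ⊆ interior V ∧ V ⊆ U)
    ⟨∅, isClopen_empty.isClopenClosed, empty_subset _, empty_subset _⟩ ?_ ?_ fun x hx ↦ ?_
  · rintro s t hst ⟨V, hV, htV, hVU⟩
    exact ⟨V, hV, hst.trans htV, hVU⟩
  · rintro s t ⟨V, hV, hsV, hVU⟩ ⟨W, hW, htW, hWU⟩
    exact ⟨V ∪ W, hV.union hW, (union_subset_union hsV htW).trans
      (union_subset (interior_mono subset_union_left) (interior_mono subset_union_right)),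
      union_subset hVU hWU⟩
  · obtain ⟨V, hVx, hVU, hV⟩ := hX x U (hU.mem_nhds (hKU hx))
    exact ⟨interior V, mem_nhdsWithin_of_mem_nhds (interior_mem_nhds.2 hVx), V, hV, subset_rfl, hVU⟩

theorem IsClopenClosed.exists_isClopen_of_disjoint {V K : Set X} (hV : IsClopenClosed V)
    (hK : IsCompact K) (h : Disjoint K V) : ∃ C, IsClopen C ∧ K ⊆ C ∧ Disjoint C V := by
  refine hK.induction_on (p := fun s ↦ ∃ C, IsClopen C ∧ s ⊆ C ∧ Disjoint C V)
    ⟨∅, isClopen_empty, subset_rfl, empty_disjoint V⟩ ?_ ?_ fun x hx ↦ ?_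
  · rintro s t hst ⟨C, hC, htC, hd⟩
    exact ⟨C, hC, hst.trans htC, hd⟩
  · rintro s t ⟨C, hC, hsC, hd⟩ ⟨D, hD, htD, hd'⟩
    exact ⟨C ∪ D, hC.union hD, union_subset_union hsC htD, hd.union_left hd'⟩
  · obtain ⟨C, hC, hxC, hd⟩ := hV x (disjoint_left.1 h hx)
    exact ⟨C, mem_nhdsWithin_of_mem_nhds (hC.isOpen.mem_nhds hxC), C, hC, subset_rfl, hd⟩

namespace TopologicalSpace.NonemptyCompacts

theorem isClopen_subsets_of_isClopen {C : Set X} (hC : IsClopen C) :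
    IsClopen {K : NonemptyCompacts X | ↑K ⊆ C} :=
  ⟨isClosed_subsets_of_isClosed hC.isClosed, isOpen_subsets_of_isOpen hC.isOpen⟩

theorem isClopen_inter_nonempty_of_isClopen {C : Set X} (hC : IsClopen C) :
    IsClopen {K : NonemptyCompacts X | (↑K ∩ C).Nonempty} :=
  ⟨isClosed_inter_nonempty_of_isClosed hC.isClosed, isOpen_inter_nonempty_of_isOpen hC.isOpen⟩

theorem isClopenClosed_subsets {V : Set X} (hV : IsClopenClosed V) :
    IsClopenClosed {K : NonemptyCompacts X | ↑K ⊆ V} := by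
  intro L hL
  obtain ⟨y, hyL, hyV⟩ := not_subset.1 hL
  obtain ⟨C, hC, hyC, hd⟩ := hV y hyV
  refine ⟨_, isClopen_inter_nonempty_of_isClopen hC, ⟨y, hyL, hyC⟩, disjoint_left.2 ?_⟩
  rintro K ⟨z, hzK, hzC⟩ hKV
  exact disjoint_left.1 hd hzC (hKV hzK)

/-- Compactness of a set missing `V` turns pointwise separation from `V` into a single clopen
superset, whose subsets form a clopen family. -/
theorem isClopenClosed_inter_nonempty {V : Set X} (hV : IsClopenClosed V) :
    IsClopenClosed {K : NonemptyCompacts X | (↑K ∩ V).Nonempty} := by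
  intro L hL
  obtain ⟨C, hC, hLC, hd⟩ := hV.exists_isClopen_of_disjoint L.isCompact
    (disjoint_iff_inter_eq_empty.2 (not_nonempty_iff_eq_empty.1 hL))
  refine ⟨_, isClopen_subsets_of_isClopen hC, hLC, disjoint_left.2 ?_⟩
  rintro K hKC ⟨z, hzK, hzV⟩
  exact disjoint_left.1 hd (hKC hzK) hzV

/-- The hyperspace of an almost zero-dimensional space is almost zero-dimensional. -/
theorem isAlmostZeroDimensional (hX : IsAlmostZeroDimensional X) :
    IsAlmostZeroDimensional (NonemptyCompacts X) := by
  rw [isAlmostZeroDimensional_iff]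
  intro K N hN
  obtain ⟨_, ⟨u, ⟨hu, -, huo⟩, rfl⟩, ⟨hKu, hKu'⟩, huN⟩ := isTopologicalBasis.mem_nhds_iff.1 hN
  obtain ⟨V, hV, hKV, hVu⟩ :=
    hX.exists_isClopenClosed_between K.isCompact (isOpen_sUnion huo) hKu
  have hW (U : Set X) (hU : U ∈ u) : ∃ W, IsClopenClosed W ∧ (↑K ∩ interior W).Nonempty ∧ W ⊆ U := by
    obtain ⟨p, hpK, hpU⟩ := hKu' U hU
    obtain ⟨W, hWp, hWU, hW⟩ :=
      isAlmostZeroDimensional_iff.1 hX p U ((huo U hU).mem_nhds hpU)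
    exact ⟨W, hW, ⟨p, hpK, mem_interior_iff_mem_nhds.2 hWp⟩, hWU⟩
  choose! W hWc hKW hWU using hW
  refine ⟨{L | ↑L ⊆ V} ∩ ⋂ U ∈ u, {L | (↑L ∩ W U).Nonempty}, ?_, ?_, ?_⟩
  · refine Filter.inter_mem ?_ ((Filter.biInter_mem hu).2 fun U hU ↦ ?_)
    · filter_upwards [(isOpen_subsets_of_isOpen isOpen_interior).mem_nhds hKV] with L hL
      exact hL.trans interior_subset
    · filter_upwards [(isOpen_inter_nonempty_of_isOpen isOpen_interior).mem_nhds (hKW U hU)]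
        with L hL
      exact hL.mono (inter_subset_inter_right _ interior_subset)
  · rintro L ⟨hLV, hLW⟩
    exact huN ⟨hLV.trans hVu, fun U hU ↦
      (mem_iInter₂.1 hLW U hU).mono (inter_subset_inter_right _ (hWU U hU))⟩
  · intro L hL
    by_cases hLV : ↑L ⊆ V
    · have : ∃ U ∈ u, ¬ (↑L ∩ W U).Nonempty := by
        by_contra! h
        exact hL ⟨hLV, mem_iInter₂.2 h⟩
      obtain ⟨U, hU, hLU⟩ := this
      obtain ⟨C, hC, hLC, hd⟩ := isClopenClosed_inter_nonempty (hWc U hU) L hLU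
      exact ⟨C, hC, hLC, hd.mono_right (inter_subset_right.trans (biInter_subset_of_mem hU))⟩
    · obtain ⟨C, hC, hLC, hd⟩ := isClopenClosed_subsets hV L hLV
      exact ⟨C, hC, hLC, hd.mono_right inter_subset_left⟩

/-- The hyperspace has small inductive dimension at most zero if and only if the space does. -/
theorem hasSmallInductiveDimensionLT_one_iff :
    HasSmallInductiveDimensionLT (NonemptyCompacts X) 1 ↔ HasSmallInductiveDimensionLT X 1 := by
  simp_rw [_root_.hasSmallInductiveDimensionLT_one_iff]
  constructor
  · intro h
    -- The space embeds as the singletons, and clopen sets pull back to clopen sets.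
    refine (h.isInducing isEmbedding_singleton.isInducing).of_isOpen_of_subset
      (fun _ hU ↦ hU.isOpen) ?_
    rintro _ ⟨U, hU, rfl⟩
    exact hU.preimage continuous_singleton
  · intro h
    refine h.nonemptyCompacts.of_isOpen_of_subset (fun _ hU ↦ hU.isOpen) ?_
    rintro _ ⟨u, ⟨hu, -, huc⟩, rfl⟩
    have hU : IsClopen (⋃₀ u) := by
      rw [sUnion_eq_biUnion]
      exact hu.isClopen_biUnion fun U hU ↦ huc hU
    have := (isClopen_subsets_of_isClopen hU).inter
      (hu.isClopen_biInter fun U hU ↦ isClopen_inter_nonempty_of_isClopen (huc hU))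
    change IsClopen _
    convert this using 1
    ext L
    simp

end TopologicalSpace.NonemptyCompacts

end Hyperspace

theorem smallInductiveDimension_eq_one_iff {X : Type*} [TopologicalSpace X]
    (h : HasSmallInductiveDimensionLE X 1) :
    smallInductiveDimension X = 1 ↔ ¬ HasSmallInductiveDimensionLT X 1 := by
  have hle := smallInductiveDimension_le_iff.2 h
  rw [← smallInductiveDimension_lt_iff, not_lt]
  exact ⟨fun h ↦ h.ge, fun h ↦ hle.antisymm h⟩

/-- `TopologicalSpace.NonemptyCompacts X` is the hyperspace of nonempty compact subsets of `X`;
its topology instance is the Vietoris topology. -/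
theorem mainTheorem9 (X : Type*) [TopologicalSpace X]
    [TopologicalSpace.MetrizableSpace X] [TopologicalSpace.SeparableSpace X]
    (hX : IsAlmostZeroDimensional X) :
    smallInductiveDimension (TopologicalSpace.NonemptyCompacts X) ≤ 1 ∧
      (smallInductiveDimension (TopologicalSpace.NonemptyCompacts X) = 1 ↔
        smallInductiveDimension X = 1) := by
  have : SecondCountableTopology X := by
    let _ := metrizableSpaceMetric X
    exact UniformSpace.secondCountable_of_separable X
  have hK := (NonemptyCompacts.isAlmostZeroDimensional hX).hasSmallInductiveDimensionLE_one
  refine ⟨smallInductiveDimension_le_iff.2 hK, ?_⟩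
  rw [smallInductiveDimension_eq_one_iff hK,
    smallInductiveDimension_eq_one_iff hX.hasSmallInductiveDimensionLE_one,
    NonemptyCompacts.hasSmallInductiveDimensionLT_one_iff]
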